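/- Let $\mathcal A$ be a locally finitely presentable category (locally small, cocomplete, with a small family of finitely presentable objects of which every object is a filtered colimit), and let $\mathcal A_f$ be a small category equivalent to the full subcategory of finitely presentable objects of $\mathcal A$. Let $\mathbf{LexProf}$ be the bicategory whose objects are small categories with finite limits; whose 1-cells $M\colon \mathbb A \to \mathbb B$ are functors $M\colon \mathbb A^{\mathrm{op}}\times\mathbb B\to \mathbf{Set}$ that preserve finite limits in the second variable; whose 2-cells are natural transformations; whose identity 1-cells are $I_{\mathbb A}(a',a)=\mathbb A(a',a)$; and whose composition, for $M\colon\mathbb A\to\mathbb B$ and $N\colon\mathbb B\to\mathbb C$, is $$(N\otimes M)(a,c)=\int^{b\in\mathbb B} N(b,c)\times M(a,b).$$ For a bicategory $\mathcal W$ with composition $\otimes$ and identities $I_x$, a $\mathcal W$-category $\mathcal C$ consists of a set of objects, each object $X$ having an extent $\epsilon X\in\mathrm{ob}\,\mathcal W$; for objects $X,Y$ a 1-cell $\mathcal C(X,Y)\colon\epsilon X\to\epsilon Y$; and 2-cells $\mathcal C(Y,Z)\otimes\mathcal C(X,Y)\to\mathcal C(X,Z)$ and $I_{\epsilon X}\to\mathcal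 C(X,X)$ satisfying the associativity and unit axioms. A $\mathcal W$-functor $F\colon\mathcal C\to\mathcal D$ consists of an extent-preserving function on objects and 2-cells $\mathcal C(X,Y)\to\mathcal D(FX,FY)$ compatible with composition and identities. Then the category of finitary monads on $\mathcal A$ (monads whose underlying functor preserves filtered colimits, with monad morphisms over $\mathcal A$) is equivalent to the category of $\mathbf{LexProf}$-categories with a single object, whose extent is $\mathcal A_f^{\mathrm{op}}$, and $\mathbf{LexProf}$-functors between them. -/

import Mathlib

open CategoryTheory Limits Opposite Bicategory

universe w v u t

/-! ### Lex profunctors -/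

/-- An object of the bicategory of lex profunctors: a small category with finite limits. -/
structure LexProf : Type (w + 1) where
  carrier : Type w
  [category : SmallCategory carrier]
  [hasFiniteLimits : HasFiniteLimits carrier]

namespace LexProf

instance : CoeSort LexProf.{w} (Type w) := ⟨LexProf.carrier⟩

attribute [instance] LexProf.category LexProf.hasFiniteLimits

/-- The functors `Aᵒᵖ × B ⥤ Type w` (in curried form) that preserve finite limits in their
second variable. -/
def isLex (A B : LexProf.{w}) : ObjectProperty (Aᵒᵖ ⥤ B ⥤ Type w) :=
  fun M ↦ ∀ a, PreservesFiniteLimits (M.obj a)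

section Comp

variable {A B C : LexProf.{w}} (M : Aᵒᵖ ⥤ B ⥤ Type w) (N : Bᵒᵖ ⥤ C ⥤ Type w)

/-- The relation on `∐ b, M(a, b) × N(b, c)` whose quotient is the coend over `b`. -/
inductive CompRel (a : Aᵒᵖ) (c : C) :
    (Σ b : B, (M.obj a).obj b × (N.obj (op b)).obj c) →
      (Σ b : B, (M.obj a).obj b × (N.obj (op b)).obj c) → Prop
  | mk {b b' : B} (f : b ⟶ b') (x : (M.obj a).obj b) (y : (N.obj (op b')).obj c) :
      CompRel a c ⟨b', (M.obj a).map f x, y⟩ ⟨b, x, (N.map f.op).app c y⟩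

/-- The set `(N ⊗ M)(a, c) = ∫^b N(b, c) × M(a, b)`. -/
def CompObj (a : Aᵒᵖ) (c : C) : Type w := Quot (CompRel M N a c)

variable {M N} in
/-- The class in the coend of a pair `x ∈ M(a, b)`, `y ∈ N(b, c)`. -/
def CompObj.mk {a : Aᵒᵖ} {c : C} (b : B) (x : (M.obj a).obj b) (y : (N.obj (op b)).obj c) :
    CompObj M N a c := Quot.mk _ ⟨b, x, y⟩

variable {M N} in
theorem CompObj.sound {a : Aᵒᵖ} {c : C} {b b' : B} (f : b ⟶ b') (x : (M.obj a).obj b)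
    (y : (N.obj (op b')).obj c) :
    (CompObj.mk b' ((M.obj a).map f x) y : CompObj M N a c) =
      CompObj.mk b x ((N.map f.op).app c y) :=
  Quot.sound (CompRel.mk f x y)

variable {M N} in
theorem CompObj.ind {a : Aᵒᵖ} {c : C} {P : CompObj M N a c → Prop}
    (h : ∀ b x y, P (CompObj.mk b x y)) (z : CompObj M N a c) : P z :=
  Quot.ind (fun ⟨b, x, y⟩ ↦ h b x y) z

variable {M N} in
/-- Functions out of the coend are dinatural families of functions. -/
def CompObj.desc {a : Aᵒᵖ} {c : C} {X : Type w}
    (f : ∀ b : B, (M.obj a).obj b → (N.obj (op b)).obj c → X)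
    (hf : ∀ {b b' : B} (g : b ⟶ b') (x : (M.obj a).obj b) (y : (N.obj (op b')).obj c),
      f b' ((M.obj a).map g x) y = f b x ((N.map g.op).app c y)) : CompObj M N a c → X :=
  Quot.lift (fun z ↦ f z.1 z.2.1 z.2.2) (by rintro _ _ ⟨g, x, y⟩; exact hf g x y)

/-- The composite profunctor `N ⊗ M`. -/
def compFunctor : Aᵒᵖ ⥤ C ⥤ Type w where
  obj a :=
    { obj := fun c ↦ CompObj M N a c
      map := fun {c c'} h ↦ ↾(CompObj.desc (fun b x y ↦ CompObj.mk b x ((N.obj (op b)).map h y))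
        (fun g x y ↦ by
          rw [CompObj.sound, NatTrans.naturality_apply]))
      map_id := fun c ↦ by
        ext z; induction z using CompObj.ind with | h b x y => simp [CompObj.desc, CompObj.mk]; rfl
      map_comp := fun h h' ↦ by
        ext z; induction z using CompObj.ind with | h b x y => simp [CompObj.desc, CompObj.mk]; rfl }
  map {a a'} k :=
    { app := fun c ↦ ↾(CompObj.desc (fun b x y ↦ CompObj.mk b ((M.map k).app b x) y)
        (fun g x y ↦ by
          rw [NatTrans.naturality_apply, CompObj.sound]))
      naturality := fun c c' h ↦ by
        ext z; induction z using CompObj.ind with | h b x y => rfl }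
  map_id a := by
    ext c z; induction z using CompObj.ind with | h b x y => simp [CompObj.desc, CompObj.mk]; rfl
  map_comp h h' := by
    ext c z; induction z using CompObj.ind with | h b x y => simp [CompObj.desc, CompObj.mk]; rfl

end Comp

/-- The coend defining `(N ⊗ M)(a, c)` is the colimit of `N(b, c)` over the pairs `x ∈ M(a, b)`. -/
def compIsColimit {A B C : LexProf.{w}} (M : Aᵒᵖ ⥤ B ⥤ Type w) (N : Bᵒᵖ ⥤ C ⥤ Type w)
    (a : Aᵒᵖ) (c : C) :
    IsColimit (show Cocone (((CategoryOfElements.π (M.obj a)).op ⋙ N).flip.obj c) from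
      { pt := CompObj M N a c
        ι :=
          { app := fun e ↦ ↾(fun y ↦ CompObj.mk e.unop.1 e.unop.2 y)
            naturality := fun e e' f ↦ by
              ext y
              have := CompObj.sound (M := M) (N := N) (a := a) (c := c) f.unop.1 e'.unop.2 y
              rw [f.unop.2] at this
              exact this.symm } }) where
  desc s := ↾(CompObj.desc (fun b x y ↦ s.ι.app (op ((M.obj a).elementsMk b x)) y)
    (fun {b b'} g x y ↦ by
      have := s.w (Quiver.Hom.op (CategoryOfElements.homMk ((M.obj a).elementsMk b x)
        ((M.obj a).elementsMk b' ((M.obj a).map g x)) g rfl))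
      exact (ConcreteCategory.congr_hom this y).symm))
  fac s e := by ext y; rfl
  uniq s m hm := by
    ext z; induction z using CompObj.ind with
    | h b x y => exact ConcreteCategory.congr_hom (hm (op ((M.obj a).elementsMk b x))) y

theorem isLex_comp {A B C : LexProf.{w}} {M : Aᵒᵖ ⥤ B ⥤ Type w} {N : Bᵒᵖ ⥤ C ⥤ Type w}
    (hM : isLex A B M) (hN : isLex B C N) : isLex A C (compFunctor M N) := fun a ↦ by
  have := hM a
  have := (M.obj a).isCofiltered_elements
  let G : C ⥤ (M.obj a).Elementsᵒᵖ ⥤ Type w := ((CategoryOfElements.π (M.obj a)).op ⋙ N).flip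
  have : PreservesFiniteLimits G := by
    refine ⟨fun J _ _ ↦ preservesLimitsOfShape_of_evaluation _ _ fun e ↦ ?_⟩
    have := hN (op e.unop.1)
    exact inferInstanceAs (PreservesLimitsOfShape J (N.obj (op e.unop.1)))
  let i : G ⋙ colim ≅ (compFunctor M N).obj a :=
    NatIso.ofComponents
      (fun c ↦ (colimit.isColimit (G.obj c)).coconePointUniqueUpToIso (compIsColimit M N a c))
      (fun {c c'} f ↦ colimit.hom_ext fun e ↦ by
        have h (c₀ : C) := IsColimit.comp_coconePointUniqueUpToIso_hom
          (colimit.isColimit (G.obj c₀)) (compIsColimit M N a c₀) e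
        dsimp
        rw [ι_colimMap_assoc]
        refine (congrArg ((G.map f).app e ≫ ·) (h c')).trans ?_
        exact (congrArg (· ≫ ((compFunctor M N).obj a).map f) (h c)).symm)
  exact preservesFiniteLimits_of_natIso i

/-- The whiskering `N ⊗ η`. -/
def whiskerRightNat {A B C : LexProf.{w}} {M M' : Aᵒᵖ ⥤ B ⥤ Type w} (η : M ⟶ M')
    (N : Bᵒᵖ ⥤ C ⥤ Type w) : compFunctor M N ⟶ compFunctor M' N where
  app a :=
    { app := fun c ↦ ↾(CompObj.desc (fun b x y ↦ CompObj.mk b ((η.app a).app b x) y)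
        (fun g x y ↦ by rw [NatTrans.naturality_apply, CompObj.sound]))
      naturality := fun c c' h ↦ by
        ext z; induction z using CompObj.ind with | h b x y => rfl }
  naturality a a' k := by
    ext c z; induction z using CompObj.ind with
    | h b x y =>
      have := ConcreteCategory.congr_hom (NatTrans.congr_app (η.naturality k) b) x
      exact congrArg (fun x' ↦ CompObj.mk b x' y) this

/-- The whiskering `θ ⊗ M`. -/
def whiskerLeftNat {A B C : LexProf.{w}} (M : Aᵒᵖ ⥤ B ⥤ Type w) {N N' : Bᵒᵖ ⥤ C ⥤ Type w}
    (θ : N ⟶ N') : compFunctor M N ⟶ compFunctor M N' where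
  app a :=
    { app := fun c ↦ ↾(CompObj.desc (fun b x y ↦ CompObj.mk b x ((θ.app (op b)).app c y))
        (fun g x y ↦ by
          rw [CompObj.sound]
          have := ConcreteCategory.congr_hom (NatTrans.congr_app (θ.naturality g.op) c) y
          exact congrArg (fun y' ↦ CompObj.mk _ x y') this.symm))
      naturality := fun c c' h ↦ by
        ext z; induction z using CompObj.ind with
        | h b x y =>
          exact congrArg (fun y' ↦ CompObj.mk b x y') (NatTrans.naturality_apply (θ.app (op b)) h y) }
  naturality a a' k := by
    ext c z; induction z using CompObj.ind with | h b x y => rfl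

/-- The associativity isomorphism `P ⊗ (N ⊗ M) ≅ (P ⊗ N) ⊗ M`. -/
def assocNat {A B C D : LexProf.{w}} (M : Aᵒᵖ ⥤ B ⥤ Type w) (N : Bᵒᵖ ⥤ C ⥤ Type w)
    (P : Cᵒᵖ ⥤ D ⥤ Type w) :
    compFunctor (compFunctor M N) P ≅ compFunctor M (compFunctor N P) where
  hom :=
    { app := fun a ↦
        { app := fun d ↦ ↾(CompObj.desc
            (fun c u z ↦ CompObj.desc (fun b x y ↦ CompObj.mk b x (CompObj.mk c y z))
              (fun g x y ↦ CompObj.sound (M := M) (N := compFunctor N P) g x (CompObj.mk c y z)) u)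
            (fun g u z ↦ by
              induction u using CompObj.ind with
              | h b x y => exact congrArg (CompObj.mk b x) (CompObj.sound g y z)))
          naturality := fun d d' h ↦ by
            ext v; induction v using CompObj.ind with
            | h c u z => induction u using CompObj.ind with | h b x y => rfl }
      naturality := fun a a' k ↦ by
        ext d v; induction v using CompObj.ind with
        | h c u z => induction u using CompObj.ind with | h b x y => rfl }
  inv :=
    { app := fun a ↦
        { app := fun d ↦ ↾(CompObj.desc
            (fun b x u ↦ CompObj.desc (fun c y z ↦ CompObj.mk c (CompObj.mk b x y) z)
              (fun g y z ↦ CompObj.sound (M := compFunctor M N) (N := P) g (CompObj.mk b x y) z) u)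
            (fun g x u ↦ by
              induction u using CompObj.ind with
              | h c y z => exact congrArg (fun t ↦ CompObj.mk c t z) (CompObj.sound g x y)))
          naturality := fun d d' h ↦ by
            ext v; induction v using CompObj.ind with
            | h b x u => induction u using CompObj.ind with | h c y z => rfl }
      naturality := fun a a' k ↦ by
        ext d v; induction v using CompObj.ind with
        | h b x u => induction u using CompObj.ind with | h c y z => rfl }
  hom_inv_id := by
    ext a d v; induction v using CompObj.ind with
    | h c u z => induction u using CompObj.ind with | h b x y => rfl
  inv_hom_id := by
    ext a d v; induction v using CompObj.ind with
    | h b x u => induction u using CompObj.ind with | h c y z => rfl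

/-- The unit isomorphism `M ⊗ I ≅ M`. -/
def leftUnitNat {A B : LexProf.{w}} (M : Aᵒᵖ ⥤ B ⥤ Type w) :
    compFunctor (A := A) (B := A) (C := B) coyoneda M ≅ M where
  hom :=
    { app := fun a ↦
        { app := fun b ↦ ↾(CompObj.desc
            (fun a' (f : a.unop ⟶ a') x ↦ (M.map f.op).app b x)
            (fun g f x ↦ by
              change (M.map (f ≫ g).op).app b x = _
              simp))
          naturality := fun b b' h ↦ by
            ext v; induction v using CompObj.ind with
            | h a' f x => exact NatTrans.naturality_apply (M.map (Quiver.Hom.op f)) h x }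
      naturality := fun a a' k ↦ by
        ext b v; induction v using CompObj.ind with
        | h a'' f x =>
          change (M.map (k.unop ≫ f).op).app b x = (M.map k).app b ((M.map (Quiver.Hom.op f)).app b x)
          simp }
  inv :=
    { app := fun a ↦
        { app := fun b ↦ ↾(fun x ↦ CompObj.mk a.unop (𝟙 a.unop) x)
          naturality := fun b b' h ↦ rfl }
      naturality := fun a a' k ↦ by
        ext b x
        have := CompObj.sound (M := coyoneda (C := A)) (N := M) (a := a') (c := b) k.unop
          (𝟙 a'.unop) x
        refine this.symm.trans ?_
        exact congrArg (fun t ↦ CompObj.mk (M := coyoneda (C := A)) (N := M) a.unop t x)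
          ((Category.id_comp k.unop).trans (Category.comp_id k.unop).symm) }
  hom_inv_id := by
    ext a b v; induction v using CompObj.ind with
    | h a' f x =>
      have := CompObj.sound (M := coyoneda (C := A)) (N := M) (a := a) (c := b) f
          (𝟙 a.unop) x
      refine this.symm.trans ?_
      exact congrArg (fun t ↦ CompObj.mk (M := coyoneda (C := A)) (N := M) a' t x)
        (Category.id_comp f)
  inv_hom_id := by
    ext a b x
    change (M.map (𝟙 a.unop).op).app b x = x
    simp

/-- The unit isomorphism `I ⊗ M ≅ M`. -/
def rightUnitNat {A B : LexProf.{w}} (M : Aᵒᵖ ⥤ B ⥤ Type w) :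
    compFunctor (A := A) (B := B) (C := B) M coyoneda ≅ M where
  hom :=
    { app := fun a ↦
        { app := fun b ↦ ↾(CompObj.desc (fun b' x (f : b' ⟶ b) ↦ (M.obj a).map f x)
            (fun g x f ↦ by
              change _ = (M.obj a).map (g ≫ f) x
              simp))
          naturality := fun b b' h ↦ by
            ext v; induction v using CompObj.ind with
            | h b'' x f =>
              change (M.obj a).map (f ≫ h) x = (M.obj a).map h ((M.obj a).map f x)
              simp }
      naturality := fun a a' k ↦ by
        ext b v; induction v using CompObj.ind with
        | h b' x f => exact (NatTrans.naturality_apply (M.map k) f x).symm }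
  inv :=
    { app := fun a ↦
        { app := fun b ↦ ↾(fun x ↦ CompObj.mk b x (𝟙 b))
          naturality := fun b b' h ↦ by
            ext x
            refine (CompObj.sound (M := M) (N := coyoneda (C := B)) h x (𝟙 b')).trans ?_
            exact congrArg (fun t ↦ CompObj.mk (M := M) (N := coyoneda (C := B)) b x t)
              ((Category.comp_id h).trans (Category.id_comp h).symm) }
      naturality := fun a a' k ↦ rfl }
  hom_inv_id := by
    ext a b v; induction v using CompObj.ind with
    | h b' x f =>
      refine (CompObj.sound (M := M) (N := coyoneda (C := B)) f x (𝟙 b)).trans ?_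
      exact congrArg (fun t ↦ CompObj.mk (M := M) (N := coyoneda (C := B)) b' x t)
        (Category.comp_id f)
  inv_hom_id := by
    ext a b x
    change (M.obj a).map (𝟙 b) x = x
    simp

/-- A 1-cell `A ⟶ B` is a functor `Aᵒᵖ × B ⥤ Type w` that preserves finite limits in its second
variable; the identity is `(a', a) ↦ (a' ⟶ a)`, and `M ≫ N` is `N ⊗ M`. -/
instance : CategoryStruct LexProf.{w} where
  Hom A B := (isLex A B).FullSubcategory
  id _ := ⟨coyoneda, fun _ ↦ inferInstance⟩
  comp M N := ⟨compFunctor M.obj N.obj, isLex_comp M.property N.property⟩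

/-- 2-cells are natural transformations. -/
instance (A B : LexProf.{w}) : Category (A ⟶ B) :=
  inferInstanceAs (Category (isLex A B).FullSubcategory)

/-- The whiskering `θ ⊗ M` of a 2-cell by a 1-cell. -/
def whiskerL {A B C : LexProf.{w}} (M : A ⟶ B) {N N' : B ⟶ C} (θ : N ⟶ N') : M ≫ N ⟶ M ≫ N' :=
  ObjectProperty.homMk (whiskerLeftNat M.obj θ.hom)

/-- The whiskering `N ⊗ η` of a 2-cell by a 1-cell. -/
def whiskerR {A B C : LexProf.{w}} {M M' : A ⟶ B} (η : M ⟶ M') (N : B ⟶ C) : M ≫ N ⟶ M' ≫ N :=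
  ObjectProperty.homMk (whiskerRightNat η.hom N.obj)

/-- The associativity 2-cell. -/
def assoc {A B C D : LexProf.{w}} (M : A ⟶ B) (N : B ⟶ C) (P : C ⟶ D) :
    (M ≫ N) ≫ P ≅ M ≫ N ≫ P :=
  ObjectProperty.isoMk _ (assocNat M.obj N.obj P.obj)

/-- The unit 2-cell `M ⊗ I ≅ M`. -/
def leftUnit {A B : LexProf.{w}} (M : A ⟶ B) : 𝟙 A ≫ M ≅ M :=
  ObjectProperty.isoMk _ (leftUnitNat M.obj)

/-- The unit 2-cell `I ⊗ M ≅ M`. -/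
def rightUnit {A B : LexProf.{w}} (M : A ⟶ B) : M ≫ 𝟙 B ≅ M :=
  ObjectProperty.isoMk _ (rightUnitNat M.obj)

theorem hom₂_ext {A B : LexProf.{w}} {M N : A ⟶ B} {η θ : M ⟶ N}
    (h : ∀ a b (x : (M.obj.obj a).obj b), (η.hom.app a).app b x = (θ.hom.app a).app b x) :
    η = θ := by
  apply ObjectProperty.hom_ext
  ext a b x
  exact h a b x

theorem comp_hom₂_ext {A B C : LexProf.{w}} {M : A ⟶ B} {N : B ⟶ C} {P : A ⟶ C}
    {η θ : M ≫ N ⟶ P}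
    (h : ∀ a c b (x : (M.obj.obj a).obj b) (y : (N.obj.obj (op b)).obj c),
      (η.hom.app a).app c (CompObj.mk b x y) = (θ.hom.app a).app c (CompObj.mk b x y)) :
    η = θ :=
  hom₂_ext fun a c z ↦ CompObj.ind (P := fun z ↦ (η.hom.app a).app c z = (θ.hom.app a).app c z)
    (h a c) z

/-- The bicategory of lex profunctors. -/
instance bicategory : Bicategory LexProf.{w} where
  whiskerLeft M _ _ θ := whiskerL M θ
  whiskerRight η N := whiskerR η N
  associator M N P := assoc M N P
  leftUnitor M := leftUnit M
  rightUnitor M := rightUnit M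
  whiskerLeft_id M N := by refine comp_hom₂_ext fun a c b x y ↦ rfl
  whiskerLeft_comp M _ _ _ θ θ' := by refine comp_hom₂_ext fun a c b x y ↦ rfl
  id_whiskerLeft θ := by
    rw [← Category.assoc, Iso.eq_comp_inv]
    refine comp_hom₂_ext fun a c b x y ↦ ?_
    exact (ConcreteCategory.congr_hom (NatTrans.congr_app (θ.hom.naturality
      (Quiver.Hom.op x)) c) y).symm
  comp_whiskerLeft M N _ _ θ := by
    refine comp_hom₂_ext fun a c b x y ↦ ?_
    obtain ⟨⟨_, _, _⟩⟩ := x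
    rfl
  id_whiskerRight M N := by refine comp_hom₂_ext fun a c b x y ↦ rfl
  comp_whiskerRight η η' N := by refine comp_hom₂_ext fun a c b x y ↦ rfl
  whiskerRight_id η := by
    rw [← Category.assoc, Iso.eq_comp_inv]
    refine comp_hom₂_ext fun a c b x y ↦ ?_
    exact (ConcreteCategory.congr_hom ((η.hom.app a).naturality y) x).symm
  whiskerRight_comp η N P := by
    refine comp_hom₂_ext fun a c b x y ↦ ?_
    obtain ⟨⟨_, _, _⟩⟩ := y
    rfl
  whisker_assoc M _ _ η P := by
    refine comp_hom₂_ext fun a c b x y ↦ ?_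
    obtain ⟨⟨_, _, _⟩⟩ := x
    rfl
  whisker_exchange η θ := by refine comp_hom₂_ext fun a c b x y ↦ rfl
  pentagon M N P Q := by
    refine comp_hom₂_ext fun a c b x y ↦ ?_
    obtain ⟨⟨_, ⟨⟨_, _, _⟩⟩, _⟩⟩ := x
    rfl
  triangle M N := by
    refine comp_hom₂_ext fun a c b x y ↦ ?_
    obtain ⟨⟨_, x, f⟩⟩ := x
    exact (CompObj.sound (M := M.obj) (N := N.obj) f x y).symm

end LexProf

/-! ### Categories enriched in a bicategory -/

/-- A category enriched in a bicategory `W`. The set of objects with its extent function to the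
objects of `W` is given by its fibres: `Obj x` is the set of objects of extent `x`. The tensor
product `N ⊗ M` of 1-cells of `W` is `M ≫ N`. -/
structure BicatEnrichedCategory (W : Type u) [Bicategory.{w, v} W] where
  Obj : W → Type t
  hom {x y : W} (X : Obj x) (Y : Obj y) : x ⟶ y
  id {x : W} (X : Obj x) : 𝟙 x ⟶ hom X X
  comp {x y z : W} (X : Obj x) (Y : Obj y) (Z : Obj z) : hom X Y ≫ hom Y Z ⟶ hom X Z
  id_comp {x y : W} (X : Obj x) (Y : Obj y) :
    id X ▷ hom X Y ≫ comp X X Y = (λ_ (hom X Y)).hom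
  comp_id {x y : W} (X : Obj x) (Y : Obj y) :
    hom X Y ◁ id Y ≫ comp X Y Y = (ρ_ (hom X Y)).hom
  assoc {x y z a : W} (X : Obj x) (Y : Obj y) (Z : Obj z) (A : Obj a) :
    comp X Y Z ▷ hom Z A ≫ comp X Z A =
      (α_ (hom X Y) (hom Y Z) (hom Z A)).hom ≫ hom X Y ◁ comp Y Z A ≫ comp X Y A

namespace BicatEnrichedCategory

variable {W : Type u} [Bicategory.{w, v} W]

/-- A functor between categories enriched in a bicategory; it preserves extents. -/
@[ext]
structure Functor (C D : BicatEnrichedCategory.{w, v, u, t} W) where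
  obj {x : W} (X : C.Obj x) : D.Obj x
  map {x y : W} (X : C.Obj x) (Y : C.Obj y) : C.hom X Y ⟶ D.hom (obj X) (obj Y)
  map_id {x : W} (X : C.Obj x) : C.id X ≫ map X X = D.id (obj X)
  map_comp {x y z : W} (X : C.Obj x) (Y : C.Obj y) (Z : C.Obj z) :
    C.comp X Y Z ≫ map X Z =
      map X Y ▷ C.hom Y Z ≫ D.hom (obj X) (obj Y) ◁ map Y Z ≫ D.comp (obj X) (obj Y) (obj Z)

/-- The category of `W`-enriched categories and `W`-enriched functors. -/
instance : Category (BicatEnrichedCategory.{w, v, u, t} W) where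
  Hom C D := Functor C D
  id C :=
    { obj := fun X ↦ X
      map := fun X Y ↦ 𝟙 (C.hom X Y)
      map_id := by simp
      map_comp := by simp }
  comp F G :=
    { obj := fun X ↦ G.obj (F.obj X)
      map := fun X Y ↦ F.map X Y ≫ G.map (F.obj X) (F.obj Y)
      map_id := fun X ↦ by rw [← Category.assoc, F.map_id, G.map_id]
      map_comp := fun X Y Z ↦ by
        rw [← Category.assoc, F.map_comp, Category.assoc, Category.assoc, G.map_comp]
        simp only [comp_whiskerRight, Bicategory.whiskerLeft_comp, Category.assoc]
        rw [whisker_exchange_assoc] }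
  id_comp F := by
    refine Functor.ext rfl (heq_of_eq ?_)
    funext x y X Y
    exact Category.id_comp _
  comp_id F := by
    refine Functor.ext rfl (heq_of_eq ?_)
    funext x y X Y
    exact Category.comp_id _
  assoc F G H := by
    refine Functor.ext rfl (heq_of_eq ?_)
    funext x y X Y
    exact Category.assoc _ _ _

/-- `C` has exactly one object, and the extent of this object is `x`. -/
def IsOneObject (x : W) : ObjectProperty (BicatEnrichedCategory.{w, v, u, t} W) :=
  fun C ↦ ∃ X : C.Obj x, ∀ Y : Σ y, C.Obj y, Y = ⟨x, X⟩

end BicatEnrichedCategory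

/-- The category of `W`-enriched categories with a single object of extent `x`. -/
abbrev OneObjectCat {W : Type u} [Bicategory.{w, v} W] (x : W) :=
  (BicatEnrichedCategory.IsOneObject.{w, v, u, t} x).FullSubcategory

/-! ### Locally finitely presentable categories and finitary monads -/

section Lfp

variable (A : Type u) [Category.{w} A]

/-- The category of finitary monads on `A`, that is, monads whose underlying functor preserves
(small) filtered colimits; the morphisms are the morphisms of monads. -/
abbrev FinitaryMonad :=
  ObjectProperty.FullSubcategory (C := Monad A) fun T ↦ PreservesFilteredColimits T.toFunctor

/-- The full subcategory of finitely presentable objects of `A`. -/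
abbrev FinPres := (ObjectProperty.isFinitelyPresentable.{w} A).FullSubcategory

theorem hasFiniteColimits_finPres [HasFiniteColimits A] : HasFiniteColimits (FinPres A) := by
  refine ⟨fun J _ _ ↦ ?_⟩
  have := Cardinal.fact_isRegular_aleph0.{w}
  have : Finite (Arrow J) :=
    Finite.of_injective (fun f ↦ (⟨f.left, f.right, f.hom⟩ : Σ (i j : J), i ⟶ j)) (by
      rintro ⟨i, j, f⟩ ⟨i', j', f'⟩ h
      cases h
      rfl)
  have : (ObjectProperty.isFinitelyPresentable.{w} A).IsClosedUnderColimitsOfShape J :=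
    isClosedUnderColimitsOfShape_isCardinalPresentable.{w} A
      ((hasCardinalLT_aleph0_iff _).2 inferInstance)
  infer_instance

variable {A}

/-- The opposite of a small category `Af` equivalent to the full subcategory of finitely presentable
objects of `A`, as an object of the bicategory of lex profunctors. -/
def lexProfOfFinPres [IsLocallyFinitelyPresentable.{w} A] {Af : Type w} [SmallCategory Af]
    (e : Af ≌ FinPres A) : LexProf.{w} :=
  have := hasFiniteColimits_finPres A
  have : HasFiniteColimits Af := ⟨fun _ _ _ ↦ Adjunction.hasColimitsOfShape_of_equivalence e.functor⟩
  { carrier := Afᵒᵖ }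

end Lfp

/-!
A category enriched in a bicategory with a single object of extent `x` is a monoid in the monoidal
category of 1-cells `x ⟶ x` (`monEquivOneObjectCat`), and a finitary monad is a monoid in the
monoidal category of finitary endofunctors (`finitaryMonadToMon`). So it suffices that finitary
endofunctors of `A` are equivalent, as a monoidal category, to the lex profunctors from `Afᵒᵖ` to
itself.

Let `i : Af ⥤ A` be the inclusion. The equivalence (`LexProf.nerve`) sends `T` to the profunctor
`(a, b) ↦ A(i b, T (i a))`.

* It is fully faithful: every object of `A` is the canonical filtered colimit of finitely
  presentable objects, so a finitary functor is the left Kan extension of its restriction along `i`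
  (`whiskerLeft_bijective`); and the restricted Yoneda functor `X ↦ A(i -, X)` is fully faithful,
  since `i` is dense.
* It is essentially surjective: a lex presheaf on `Af` is a filtered colimit of representables, and
  the restricted Yoneda functor preserves filtered colimits, so every lex presheaf is of the form
  `A(i -, X)` (`mem_essImage_restrictedYoneda`). Hence a lex profunctor is the same as a functor
  `G : Af ⥤ A`, and `G` has a finitary extension to `A` (`extendAlong`).
* It is monoidal: the coend `∫^b A(i b, T (i a)) × A(i c, S (i b))` is `A(i c, S (T (i a)))`, since
  `S` preserves the canonical filtered colimit of `T (i a)` and `i c` is finitely presentable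
  (`LexProf.isIso_compNerve`).

A monoidal equivalence induces an equivalence between the categories of monoids.
-/

/-! ### One-object enriched categories as monoids of endo-1-cells -/

namespace BicatEnrichedCategory

variable {W : Type u} [Bicategory.{w, v} W]

/-- The family of sets over the objects of `W` with a single element, which lies over `x`. -/
inductive SingleObj (x : W) : W → Type t
  | star : SingleObj x x

/-- A monoid in the monoidal category of endo-1-cells of `x`, regarded as a one-object category. -/
def ofMon {x : W} (M : Mon (x ⟶ x)) : BicatEnrichedCategory.{w, v, u, t} W where
  Obj := SingleObj x
  hom
    | .star, .star => M.X
  id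
    | .star => MonObj.one (X := M.X)
  comp
    | .star, .star, .star => MonObj.mul (X := M.X)
  id_comp := by
    rintro _ _ ⟨⟩ ⟨⟩
    exact MonObj.one_mul M.X
  comp_id := by
    rintro _ _ ⟨⟩ ⟨⟩
    exact MonObj.mul_one M.X
  assoc := by
    rintro _ _ _ _ ⟨⟩ ⟨⟩ ⟨⟩ ⟨⟩
    exact MonObj.mul_assoc M.X

theorem isOneObject_ofMon {x : W} (M : Mon (x ⟶ x)) :
    IsOneObject x (ofMon.{w, v, u, t} M) :=
  ⟨.star, by rintro ⟨_, ⟨⟩⟩; rfl⟩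

/-- A morphism of monoids of endo-1-cells, regarded as a functor. -/
def mapOfMon {x : W} {M N : Mon (x ⟶ x)} (f : M ⟶ N) :
    Functor (ofMon.{w, v, u, t} M) (ofMon N) where
  obj X := X
  map
    | .star, .star => f.hom
  map_id := by
    rintro _ ⟨⟩
    exact IsMonHom.one_hom f.hom
  map_comp := by
    rintro _ _ _ ⟨⟩ ⟨⟩ ⟨⟩
    refine (IsMonHom.mul_hom f.hom).trans ?_
    rw [MonoidalCategory.tensorHom_def, Category.assoc]
    rfl

/-- The functor that regards monoids of endo-1-cells of `x` as one-object categories. -/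
def monToOneObjectCat (x : W) : Mon (x ⟶ x) ⥤ OneObjectCat.{w, v, u, t} x where
  obj M := ⟨ofMon M, isOneObject_ofMon M⟩
  map f := ObjectProperty.homMk (mapOfMon f)
  map_id M := by
    apply ObjectProperty.hom_ext
    refine Functor.ext rfl (heq_of_eq ?_)
    funext _ _ X Y
    obtain ⟨⟩ := X
    obtain ⟨⟩ := Y
    rfl
  map_comp f g := by
    apply ObjectProperty.hom_ext
    refine Functor.ext rfl (heq_of_eq ?_)
    funext _ _ X Y
    obtain ⟨⟩ := X
    obtain ⟨⟩ := Y
    rfl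

instance (x : W) : (monToOneObjectCat.{w, v, u, t} x).Faithful where
  map_injective {M N f g} h := by
    ext
    have h' : mapOfMon.{w, v, u, t} f = mapOfMon g := congrArg (·.hom) h
    -- The type of `F.map` depends on `F.obj`, so the two are extracted together.
    have := congrArg (fun F : Functor (ofMon.{w, v, u, t} M) (ofMon N) ↦
      (⟨F.obj .star, F.map .star .star⟩ :
        Σ Y : SingleObj x x, M.X ⟶ (ofMon.{w, v, u, t} N).hom Y Y)) h'
    exact eq_of_heq (Sigma.mk.inj this).2

/-- Every functor between the categories of two monoids comes from a morphism of monoids: its object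
function is the only one there is. -/
theorem Functor.exists_mapOfMon_eq {x : W} {M N : Mon (x ⟶ x)}
    (F : Functor (ofMon.{w, v, u, t} M) (ofMon N)) : ∃ f : M ⟶ N, mapOfMon f = F := by
  obtain ⟨obj, map, map_id, map_comp⟩ := F
  obtain rfl : @obj = fun _ X ↦ X := by
    funext y
    refine funext fun (X : SingleObj x _) ↦ ?_
    obtain ⟨⟩ := X
    generalize obj SingleObj.star = Y
    obtain ⟨⟩ := Y
    rfl
  have : IsMonHom (M := M.X) (N := N.X) (map .star .star) :=
    { one_hom := map_id .star
      mul_hom := by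
        refine (map_comp .star .star .star).trans ((Category.assoc _ _ _).symm.trans ?_)
        exact congrArg (· ≫ MonObj.mul (X := N.X)) (MonoidalCategory.tensorHom_def _ _).symm }
  refine ⟨Mon.Hom.mk (map .star .star), Functor.ext rfl (heq_of_eq ?_)⟩
  funext _ _ X Y
  obtain ⟨⟩ := X
  obtain ⟨⟩ := Y
  rfl

instance (x : W) : (monToOneObjectCat.{w, v, u, t} x).Full where
  map_surjective {M N} F := by
    obtain ⟨f, hf⟩ := Functor.exists_mapOfMon_eq F.hom
    exact ⟨f, ObjectProperty.hom_ext _ hf⟩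

/-- The monoid of endomorphisms of an object of an enriched category. -/
def endMon (C : BicatEnrichedCategory.{w, v, u, t} W) {x : W} (X : C.Obj x) : Mon (x ⟶ x) where
  X := C.hom X X
  mon :=
    { one := C.id X
      mul := C.comp X X X
      one_mul := C.id_comp X X
      mul_one := C.comp_id X X
      mul_assoc := C.assoc X X X X }

section

variable {C : BicatEnrichedCategory.{w, v, u, t} W} {x : W} {X : C.Obj x}
  (hX : ∀ Y : Σ y, C.Obj y, Y = ⟨x, X⟩)

/-- The recursion principle for the objects of a category whose only object is `X`. -/
def objRec {motive : ∀ y : W, C.Obj y → Sort*} (h : motive x X) {y : W} (Y : C.Obj y) :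
    motive y Y :=
  Eq.rec (motive := fun Z _ ↦ motive Z.1 Z.2) h (hX ⟨y, Y⟩).symm

/-- Functors out of a one-object category are determined by their values at its object. -/
theorem Functor.ext_of_isOneObject (hX : ∀ Y : Σ y, C.Obj y, Y = ⟨x, X⟩)
    {D : BicatEnrichedCategory.{w, v, u, t} W} {F G : Functor C D}
    (hobj : F.obj X = G.obj X) (hmap : HEq (F.map X X) (G.map X X)) : F = G := by
  obtain ⟨F, mapF, _, _⟩ := F
  obtain ⟨G, mapG, _, _⟩ := G
  obtain rfl : @F = @G := by
    funext y Y
    induction Y using objRec hX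
    exact hobj
  refine Functor.ext rfl (heq_of_eq ?_)
  funext y z Y Z
  induction Y using objRec hX
  induction Z using objRec hX
  exact eq_of_heq hmap

variable (C X) in
/-- The functor from the one-object category of the monoid of endomorphisms of `X`. -/
def ofMonEndMon : Functor (ofMon.{w, v, u, t} (C.endMon X)) C where
  obj
    | .star => X
  map
    | .star, .star => 𝟙 (C.hom X X)
  map_id := by
    rintro _ ⟨⟩
    exact Category.comp_id (C.id X)
  map_comp := by
    rintro _ _ _ ⟨⟩ ⟨⟩ ⟨⟩
    change C.comp X X X ≫ 𝟙 _ = 𝟙 _ ▷ _ ≫ _ ◁ 𝟙 _ ≫ C.comp X X X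
    simp

/-- If `X` is the only object, the inverse of the functor `ofMonEndMon C X`. Since the recursor of
equality reduces at every proof of `a = a`, `objRec` computes at `X`. -/
def toOfMonEndMon : Functor C (ofMon.{w, v, u, t} (C.endMon X)) where
  obj := objRec hX (motive := fun y _ ↦ SingleObj x y) .star
  map {y z} Y Z := objRec hX
    (motive := fun y Y ↦ ∀ {z : W} (Z : C.Obj z), C.hom Y Z ⟶ (ofMon (C.endMon X)).hom
      (objRec hX (motive := fun y _ ↦ SingleObj x y) .star Y)
      (objRec hX (motive := fun y _ ↦ SingleObj x y) .star Z))
    (objRec hX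
      (motive := fun z Z ↦ C.hom X Z ⟶ (ofMon (C.endMon X)).hom
        (objRec hX (motive := fun y _ ↦ SingleObj x y) .star X)
        (objRec hX (motive := fun y _ ↦ SingleObj x y) .star Z))
      (𝟙 (C.hom X X))) Y Z
  map_id Y := by
    induction Y using objRec hX
    exact Category.comp_id (C.id X)
  map_comp Y Y' Y'' := by
    induction Y using objRec hX
    induction Y' using objRec hX
    induction Y'' using objRec hX
    change C.comp X X X ≫ 𝟙 _ = 𝟙 _ ▷ _ ≫ _ ◁ 𝟙 _ ≫ C.comp X X X
    simp

/-- A one-object category is isomorphic to the one of the monoid of endomorphisms of its object. -/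
def ofMonEndMonIso : ofMon.{w, v, u, t} (C.endMon X) ≅ C where
  hom := ofMonEndMon C X
  inv := toOfMonEndMon hX
  hom_inv_id := by
    refine Functor.ext_of_isOneObject (X := SingleObj.star) (by rintro ⟨_, ⟨⟩⟩; rfl) rfl
      (heq_of_eq ?_)
    exact Category.comp_id (𝟙 (C.hom X X))
  inv_hom_id := by
    refine Functor.ext_of_isOneObject hX rfl (heq_of_eq ?_)
    exact Category.comp_id (𝟙 (C.hom X X))

end

instance (x : W) : (monToOneObjectCat.{w, v, u, t} x).EssSurj where
  mem_essImage C := by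
    obtain ⟨X, hX⟩ := C.property
    exact ⟨C.obj.endMon X, ⟨ObjectProperty.isoMk _ (ofMonEndMonIso hX)⟩⟩

/-- One-object categories of extent `x` are the monoids of endo-1-cells of `x`. -/
noncomputable def monEquivOneObjectCat (x : W) : Mon (x ⟶ x) ≌ OneObjectCat.{w, v, u, t} x :=
  have : (monToOneObjectCat.{w, v, u, t} x).IsEquivalence := { }
  (monToOneObjectCat.{w, v, u, t} x).asEquivalence

end BicatEnrichedCategory

/-! ### The restricted Yoneda functor and finitary extensions -/

section RestrictedYoneda

variable {A : Type u} [Category.{w} A] {C : Type w} [SmallCategory C] (i : C ⥤ A)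

/-- The restricted Yoneda functor `X ↦ A(i -, X)`. -/
abbrev restrictedYoneda : A ⥤ Cᵒᵖ ⥤ Type w :=
  yoneda ⋙ (Functor.whiskeringLeft _ _ _).obj i.op

/-- The restricted Yoneda functor agrees with its `ULift` version. -/
def restrictedYonedaIso : restrictedYoneda i ≅ Presheaf.restrictedULiftYoneda.{w} i :=
  NatIso.ofComponents (fun X ↦ NatIso.ofComponents (fun c ↦ Equiv.ulift.symm.toIso)
    (by cat_disch)) (by cat_disch)

instance [i.IsDense] : (restrictedYoneda i).Full := .of_iso (restrictedYonedaIso i).symm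
instance [i.IsDense] : (restrictedYoneda i).Faithful := .of_iso (restrictedYonedaIso i).symm

/-- For a fully faithful functor `i`, the presheaf `A(i -, i c)` is represented by `c`. -/
noncomputable def compRestrictedYonedaIso [i.Full] [i.Faithful] :
    i ⋙ restrictedYoneda i ≅ yoneda :=
  (NatIso.ofComponents (fun X ↦ NatIso.ofComponents
    (fun c ↦ (Functor.FullyFaithful.ofFullyFaithful i).homEquiv.toIso)
    (by cat_disch)) (by cat_disch)).symm

/-- The `ULift` version of `compRestrictedYonedaIso`. -/
noncomputable def compRestrictedULiftYonedaIso [i.Full] [i.Faithful] :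
    i ⋙ restrictedYoneda i ≅ uliftYoneda.{w} :=
  compRestrictedYonedaIso i ≪≫
  (NatIso.ofComponents (fun X ↦ NatIso.ofComponents
    (fun c ↦ Equiv.ulift.symm.toIso)
    (by cat_disch)) (by cat_disch))

theorem preservesFilteredColimits_restrictedYoneda
    (hi : ∀ c, IsFinitelyPresentable.{w} (i.obj c)) :
    PreservesFilteredColimitsOfSize.{w, w} (restrictedYoneda i) where
  preserves_filtered_colimits J _ _ := preservesColimitsOfShape_of_evaluation _ _ fun c ↦ by
    have := hi c.unop
    exact inferInstanceAs (PreservesColimitsOfShape J (coyoneda.obj (op (i.obj c.unop))))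

/-- A finite limit preserving presheaf `P` is a filtered colimit of representables. The colimit in
`A` of the same diagram of objects of `C` is preserved by the restricted Yoneda functor, which
therefore sends it to `P`. -/
theorem mem_essImage_restrictedYoneda [i.Full] [i.Faithful] [HasFilteredColimitsOfSize.{w, w} A]
    (hi : ∀ c, IsFinitelyPresentable.{w} (i.obj c)) [HasFiniteLimits Cᵒᵖ] (P : Cᵒᵖ ⥤ Type w)
    [PreservesFiniteLimits P] : (restrictedYoneda i).essImage P := by
  have := preservesFilteredColimits_restrictedYoneda i hi
  have := P.isCofiltered_elements
  have : IsFiltered (CostructuredArrow yoneda P) :=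
    IsFiltered.of_equivalence (CategoryOfElements.costructuredArrowYonedaEquivalence P)
  let F := CostructuredArrow.proj yoneda P ⋙ i
  refine ⟨colimit F, ⟨?_⟩⟩
  exact IsColimit.coconePointsIsoOfNatIso
    (isColimitOfPreserves (restrictedYoneda i) (colimit.isColimit F))
    (denseAtYoneda P)
    (Functor.isoWhiskerLeft (CostructuredArrow.proj yoneda P) (compRestrictedYonedaIso i))

/-- The finitary extension of `G` along `i`: the restricted Yoneda functor, followed by the
colimit-preserving extension of `G` to presheaves. -/
noncomputable def extendAlong [HasColimitsOfSize.{w, w} A] (G : C ⥤ A) : A ⥤ A :=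
  restrictedYoneda i ⋙ uliftYoneda.{w}.leftKanExtension G

theorem preservesFilteredColimits_extendAlong [HasColimitsOfSize.{w, w} A]
    (hi : ∀ c, IsFinitelyPresentable.{w} (i.obj c)) (G : C ⥤ A) :
    PreservesFilteredColimitsOfSize.{w, w} (extendAlong i G) where
  preserves_filtered_colimits J _ _ := by
    have := (preservesFilteredColimits_restrictedYoneda i hi).preserves_filtered_colimits J
    have := Presheaf.preservesColimitsOfSize_leftKanExtension.{w} G
    dsimp [extendAlong]
    infer_instance

/-- The functor `extendAlong i G` extends `G`. -/
noncomputable def compExtendAlongIso [HasColimitsOfSize.{w, w} A] [i.Full] [i.Faithful]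
    (G : C ⥤ A) : i ⋙ extendAlong i G ≅ G :=
  Functor.isoWhiskerRight (compRestrictedULiftYonedaIso i) _ ≪≫
    (asIso (uliftYoneda.{w}.leftKanExtensionUnit G)).symm

/-- A finitary endofunctor is the left Kan extension of its restriction along `i`, as it preserves
the canonical filtered colimits; so transformations out of it are determined on the values
of `i`. -/
theorem whiskerLeft_bijective [i.IsDense] [∀ X, IsFiltered (CostructuredArrow i X)] (T S : A ⥤ A)
    [PreservesFilteredColimitsOfSize.{w, w} T] :
    Function.Bijective (fun α : T ⟶ S ↦ Functor.whiskerLeft i α) := by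
  let E : i.LeftExtension (i ⋙ T) := Functor.LeftExtension.mk T (𝟙 _)
  have hE : E.IsPointwiseLeftKanExtension := fun X ↦
    (isColimitOfPreserves T (i.denseAt X)).ofIsoColimit (Cocone.ext (Iso.refl _) fun g ↦ by
      change T.map (𝟙 _ ≫ g.hom) ≫ 𝟙 _ = 𝟙 _ ≫ T.map g.hom
      simp)
  have : T.IsLeftKanExtension (𝟙 (i ⋙ T)) := hE.isLeftKanExtension
  convert (T.homEquivOfIsLeftKanExtension (𝟙 (i ⋙ T)) S).bijective using 1
  ext α
  simp [Functor.homEquivOfIsLeftKanExtension]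

end RestrictedYoneda

/-! ### The nerve of a finitary endofunctor -/

attribute [local instance] endofunctorMonoidalCategory

/-- The endofunctors that preserve filtered colimits. -/
def isFinitary (A : Type u) [Category.{w} A] : ObjectProperty (A ⥤ A) :=
  fun T ↦ PreservesFilteredColimits T

instance (A : Type u) [Category.{w} A] : (isFinitary A).IsMonoidal where
  prop_unit := inferInstanceAs (PreservesFilteredColimitsOfSize.{w, w} (𝟭 A))
  prop_tensor T S hT hS := by
    refine ⟨fun J _ _ ↦ ?_⟩
    have := hT.preserves_filtered_colimits J
    have := hS.preserves_filtered_colimits J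
    exact inferInstanceAs (PreservesColimitsOfShape J (T ⋙ S))

namespace LexProf

variable {A : Type u} [Category.{w} A] {C : Type w} [SmallCategory C]
  (i : C ⥤ A)

variable (C) in
/-- The opposite of a small category with finite colimits, as an object of the bicategory of lex
profunctors. -/
abbrev ofOp [HasFiniteLimits Cᵒᵖ] : LexProf.{w} := ⟨Cᵒᵖ⟩

/-- The profunctor `(a, b) ↦ A(i b, T (i a))` on `Cᵒᵖ`. -/
abbrev nerveFunctor (T : A ⥤ A) : (Cᵒᵖ)ᵒᵖ ⥤ Cᵒᵖ ⥤ Type w :=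
  unopUnop C ⋙ i ⋙ T ⋙ restrictedYoneda i

/-- The action of `nerveFunctor` on natural transformations. -/
def nerveMap {T S : A ⥤ A} (f : T ⟶ S) : nerveFunctor i T ⟶ nerveFunctor i S :=
  Functor.whiskerLeft (unopUnop C) (Functor.whiskerLeft i
    (Functor.whiskerRight f (restrictedYoneda i)))

theorem nerveMap_injective [i.IsDense] [∀ X, IsFiltered (CostructuredArrow i X)] {T S : A ⥤ A}
    [PreservesFilteredColimitsOfSize.{w, w} T] :
    Function.Injective (nerveMap i : (T ⟶ S) → _) := fun f g h ↦ by
  apply (whiskerLeft_bijective i T S).1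
  ext c
  apply (restrictedYoneda i).map_injective
  exact NatTrans.congr_app h (op (op c))

theorem nerveMap_surjective [i.IsDense] [∀ X, IsFiltered (CostructuredArrow i X)] {T S : A ⥤ A}
    [PreservesFilteredColimitsOfSize.{w, w} T] :
    Function.Surjective (nerveMap i : (T ⟶ S) → _) := fun α ↦ by
  let β : i ⋙ T ⟶ i ⋙ S :=
    { app c := (restrictedYoneda i).preimage (α.app (op (op c)))
      naturality c d f := by
        apply (restrictedYoneda i).map_injective
        rw [Functor.map_comp, Functor.map_comp, Functor.map_preimage, Functor.map_preimage]
        exact α.naturality f.op.op }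
  obtain ⟨f, hf⟩ := (whiskerLeft_bijective i T S).2 β
  refine ⟨f, ?_⟩
  ext c : 2
  refine (congrArg (restrictedYoneda i).map (NatTrans.congr_app hf c.unop.unop)).trans ?_
  exact Functor.map_preimage _ _

theorem isLex_nerveFunctor [HasFiniteLimits Cᵒᵖ] [PreservesFiniteColimits i] (T : A ⥤ A) :
    isLex (ofOp C) (ofOp C) (nerveFunctor i T) := fun a ↦ by
  have := preservesFiniteLimits_op i
  exact inferInstanceAs (PreservesFiniteLimits (i.op ⋙ yoneda.obj (T.obj (i.obj a.unop.unop))))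

/-- The functor that sends a finitary endofunctor `T` to the lex profunctor
`(a, b) ↦ A(i b, T (i a))`. -/
def nerve [HasFiniteLimits Cᵒᵖ] [PreservesFiniteColimits i] :
    (isFinitary A).FullSubcategory ⥤ (ofOp C ⟶ ofOp C) where
  obj T := ⟨nerveFunctor i T.obj, isLex_nerveFunctor i T.obj⟩
  map f := ObjectProperty.homMk (nerveMap i f.hom)
  map_id T := by
    refine hom₂_ext fun a b x ↦ ?_
    exact Category.comp_id x
  map_comp f g := by
    refine hom₂_ext fun a b x ↦ ?_
    exact (Category.assoc _ _ _).symm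

section

variable [HasFiniteLimits Cᵒᵖ] [PreservesFiniteColimits i] [i.IsDense]

instance [∀ X, IsFiltered (CostructuredArrow i X)] : (nerve i).Faithful where
  map_injective {T S f g} h := by
    have : PreservesFilteredColimitsOfSize.{w, w} T.obj := T.property
    exact ObjectProperty.hom_ext _ (nerveMap_injective i (congrArg (·.hom) h))

instance [∀ X, IsFiltered (CostructuredArrow i X)] : (nerve i).Full where
  map_surjective {T S} α := by
    have : PreservesFilteredColimitsOfSize.{w, w} T.obj := T.property
    obtain ⟨f, hf⟩ := nerveMap_surjective i α.hom
    exact ⟨ObjectProperty.homMk f, ObjectProperty.hom_ext _ hf⟩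

/-- A lex profunctor `M` is a functor from `C` to lex presheaves, hence a functor `G : C ⥤ A`. The
nerve of the finitary extension of `G` is `M`. -/
theorem essSurj_nerve [i.Full] [i.Faithful] [HasColimitsOfSize.{w, w} A]
    (hi : ∀ c, IsFinitelyPresentable.{w} (i.obj c)) : (nerve i).EssSurj where
  mem_essImage M := by
    have : HasFilteredColimitsOfSize.{w, w} A := ⟨fun _ ↦ inferInstance⟩
    let R := restrictedYoneda i
    have hM (c : C) : R.essImage ((opOp C ⋙ M.obj).obj c) := by
      have : PreservesFiniteLimits ((opOp C ⋙ M.obj).obj c) := M.property (op (op c))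
      exact mem_essImage_restrictedYoneda i hi _
    let G : C ⥤ A := R.essImage.lift (opOp C ⋙ M.obj) hM ⋙ R.toEssImage.inv
    let e : G ⋙ R ≅ opOp C ⋙ M.obj :=
      Functor.isoWhiskerLeft (R.essImage.lift (opOp C ⋙ M.obj) hM)
        (Functor.isoWhiskerRight R.toEssImage.asEquivalence.counitIso R.essImage.ι)
    -- The composite `unopUnop C ⋙ opOp C` is the identity, definitionally on objects.
    let e' : unopUnop C ⋙ opOp C ⋙ M.obj ≅ M.obj := NatIso.ofComponents fun _ ↦ Iso.refl _
    refine ⟨⟨extendAlong i G, preservesFilteredColimits_extendAlong i hi G⟩,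
      ⟨ObjectProperty.isoMk _ ?_⟩⟩
    exact Functor.isoWhiskerLeft (unopUnop C)
      (Functor.isoWhiskerRight (compExtendAlongIso i G) R ≪≫ e) ≪≫ e'

end

/-- The comparison of the identity profunctor with the nerve of the identity functor. -/
def unitNerve : (coyoneda : (Cᵒᵖ)ᵒᵖ ⥤ Cᵒᵖ ⥤ Type w) ⟶ nerveFunctor i (𝟭 A) where
  app a :=
    { app b := ↾fun f ↦ i.map f.unop
      naturality b b' g := by
        ext f
        exact i.map_comp g.unop f.unop }
  naturality a a' g := by
    ext b f
    exact i.map_comp f.unop g.unop.unop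

theorem isIso_unitNerve [i.Full] [i.Faithful] : IsIso (unitNerve i) := by
  have h (a b) : IsIso (((unitNerve i).app a).app b) := by
    rw [isIso_iff_bijective]
    exact (Functor.FullyFaithful.ofFullyFaithful i).homEquiv.bijective.comp
      Quiver.Hom.opEquiv.symm.bijective
  have h' (a) : IsIso ((unitNerve i).app a) := NatIso.isIso_of_isIso_app _
  exact NatIso.isIso_of_isIso_app _

/-- The map `∫^b A(i b, T (i a)) × A(i c, S (i b)) ⟶ A(i c, S (T (i a)))`, `(x, y) ↦ y ≫ S.map x`,
that compares the composite of two nerves with the nerve of the composite. -/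
def compNerve [HasFiniteLimits Cᵒᵖ] (T S : A ⥤ A) :
    compFunctor (A := ofOp C) (B := ofOp C) (C := ofOp C) (nerveFunctor i T) (nerveFunctor i S) ⟶
      nerveFunctor i (T ⋙ S) where
  app a :=
    { app c := ↾(CompObj.desc (fun b x y ↦ y ≫ S.map x)
        (fun g x y ↦ by
          change y ≫ S.map (i.map g.unop ≫ x) = (y ≫ S.map (i.map g.unop)) ≫ S.map x
          simp))
      naturality c c' g := by
        ext z; induction z using CompObj.ind with | h b x y =>
        exact Category.assoc (i.map g.unop) y (S.map x) }
  naturality a a' g := by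
    ext c z; induction z using CompObj.ind with | h b x y =>
    change y ≫ S.map (x ≫ T.map (i.map g.unop.unop)) =
      (y ≫ S.map x) ≫ S.map (T.map (i.map g.unop.unop))
    simp

/-- When `S` preserves filtered colimits, `S X` is the filtered colimit of the `S (i b)` over the
maps `i b ⟶ X`. As `i c` is finitely presentable, the maps `i c ⟶ S X` form the coend. -/
theorem isIso_compNerve [HasFiniteLimits Cᵒᵖ] [i.IsDense] [∀ X, IsFiltered (CostructuredArrow i X)]
    (hi : ∀ c, IsFinitelyPresentable.{w} (i.obj c)) (T S : A ⥤ A)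
    [PreservesFilteredColimitsOfSize.{w, w} S] : IsIso (compNerve i T S) := by
  have h (a c) : IsIso (((compNerve i T S).app a).app c) := by
    have := hi c.unop
    have hc := isColimitOfPreserves S (i.denseAt (T.obj (i.obj a.unop.unop)))
    have hι (j : CostructuredArrow i (T.obj (i.obj a.unop.unop))) :
        (S.mapCocone ((Functor.LeftExtension.mk (𝟭 A) i.rightUnitor.inv).coconeAt _)).ι.app j =
          S.map j.hom := congrArg (S.map ·) (Category.id_comp j.hom)
    rw [isIso_iff_bijective]
    constructor
    · intro z z' h
      induction z using CompObj.ind with | h b x y =>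
      induction z' using CompObj.ind with | h b' x' y' =>
      obtain ⟨k, u, v, huv⟩ := IsFinitelyPresentable.exists_eq_of_isColimit hc (X := i.obj c.unop)
        (i := CostructuredArrow.mk (Y := b.unop) x) (j := CostructuredArrow.mk (Y := b'.unop) x')
        y y' (by rw [hι, hι]; exact h)
      -- Moving a pair `(x₀, y₀)` along a map `g` to the stage `k` keeps its class in the coend.
      have key {b₀ : C} (x₀ : i.obj b₀ ⟶ T.obj (i.obj a.unop.unop))
          (y₀ : i.obj c.unop ⟶ S.obj (i.obj b₀)) (g : b₀ ⟶ k.left) (hg : i.map g ≫ k.hom = x₀) :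
          (CompObj.mk (op b₀) x₀ y₀ : CompObj (A := ofOp C) (B := ofOp C) (C := ofOp C)
            (nerveFunctor i T) (nerveFunctor i S) a c) =
          CompObj.mk (op k.left) k.hom (y₀ ≫ S.map (i.map g)) := by
        subst hg
        exact CompObj.sound (A := ofOp C) (B := ofOp C) (C := ofOp C) (M := nerveFunctor i T)
          (N := nerveFunctor i S) g.op k.hom y₀
      refine (key x y u.left (CostructuredArrow.w u)).trans
        (Eq.trans ?_ (key x' y' v.left (CostructuredArrow.w v)).symm)
      exact congrArg (fun t : i.obj c.unop ⟶ S.obj (i.obj k.left) ↦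
        (CompObj.mk (op k.left) k.hom t : CompObj (A := ofOp C) (B := ofOp C) (C := ofOp C)
            (nerveFunctor i T) (nerveFunctor i S) a c)) huv
    · intro (z : i.obj c.unop ⟶ S.obj (T.obj (i.obj a.unop.unop)))
      obtain ⟨j, y, hy⟩ := IsFinitelyPresentable.exists_hom_of_isColimit hc z
      rw [hι] at hy
      exact ⟨CompObj.mk (op j.left) j.hom y, hy⟩
  have h' (a) : IsIso ((compNerve i T S).app a) := NatIso.isIso_of_isIso_app _
  exact NatIso.isIso_of_isIso_app _

/-- The monoidal structure of `nerve`. -/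
noncomputable def coreMonoidalNerve [HasFiniteLimits Cᵒᵖ] [PreservesFiniteColimits i]
    [i.IsDense] [∀ X, IsFiltered (CostructuredArrow i X)] [i.Full] [i.Faithful]
    (hi : ∀ c, IsFinitelyPresentable.{w} (i.obj c)) : (nerve i).CoreMonoidal where
  εIso :=
    have := isIso_unitNerve i
    ObjectProperty.isoMk _ (@asIso _ _ _ _ (unitNerve i) this)
  μIso T S :=
    have : PreservesFilteredColimitsOfSize.{w, w} S.obj := S.property
    have := isIso_compNerve i hi T.obj S.obj
    ObjectProperty.isoMk _ (@asIso _ _ _ _ (compNerve i T.obj S.obj) this)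
  μIso_hom_natural_left {T T'} f S := by
    refine comp_hom₂_ext fun a c b x y ↦ ?_
    exact (congrArg (y ≫ ·) (S.obj.map_comp x (f.hom.app _))).trans (Category.assoc _ _ _).symm
  μIso_hom_natural_right {T T'} S f := by
    refine comp_hom₂_ext fun a c b x y ↦ ?_
    exact (Category.assoc _ _ _).trans ((congrArg (y ≫ ·) (f.hom.naturality x).symm).trans
      (Category.assoc _ _ _).symm)
  associativity T S U := by
    refine comp_hom₂_ext fun a c b x y ↦ ?_
    obtain ⟨⟨b', x, z⟩⟩ := x
    exact (Category.comp_id _).trans ((congrArg (y ≫ ·) (U.obj.map_comp z (S.obj.map x))).trans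
      (Category.assoc _ _ _).symm)
  left_unitality T := by
    refine comp_hom₂_ext fun a c b x y ↦ ?_
    exact (Category.comp_id (y ≫ T.obj.map (i.map x.unop))).symm
  right_unitality T := by
    refine comp_hom₂_ext fun a c b x y ↦ ?_
    exact (Category.comp_id (i.map y.unop ≫ x)).symm

end LexProf

/-! ### Finitary monads as monoids -/

/-- The underlying functor of a finitary monad, as a finitary endofunctor. -/
abbrev FinitaryMonad.toFinitary {A : Type u} [Category.{w} A] (T : FinitaryMonad A) :
    (isFinitary A).FullSubcategory :=
  ⟨T.obj.toFunctor, T.property⟩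

instance {A : Type u} [Category.{w} A] (T : FinitaryMonad A) : MonObj T.toFinitary where
  one := ObjectProperty.homMk T.obj.η
  mul := ObjectProperty.homMk T.obj.μ
  one_mul := ObjectProperty.hom_ext _ (MonObj.one_mul T.obj.toFunctor)
  mul_one := ObjectProperty.hom_ext _ (MonObj.mul_one T.obj.toFunctor)
  mul_assoc := ObjectProperty.hom_ext _ (MonObj.mul_assoc T.obj.toFunctor)

/-- A finitary monad is a monoid in the monoidal category of finitary endofunctors. -/
def finitaryMonadToMon (A : Type u) [Category.{w} A] :
    FinitaryMonad A ⥤ Mon (isFinitary A).FullSubcategory where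
  obj T := ⟨T.toFinitary⟩
  map {T S} f :=
    { hom := ObjectProperty.homMk f.hom.toNatTrans
      isMonHom_hom :=
        { one_hom := ObjectProperty.hom_ext _
            (IsMonHom.one_hom ((Monad.monadToMon A).map f.hom).hom)
          mul_hom := ObjectProperty.hom_ext _
            (IsMonHom.mul_hom ((Monad.monadToMon A).map f.hom).hom) } }

instance (A : Type u) [Category.{w} A] : (finitaryMonadToMon A).IsEquivalence where
  faithful := ⟨fun {T S f g} h ↦ by
    apply ObjectProperty.hom_ext
    apply MonadHom.ext
    exact congrArg (fun k ↦ k.hom.hom.app) h⟩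
  full := ⟨fun {T S} f ↦ by
    refine ⟨ObjectProperty.homMk
      { toNatTrans := f.hom.hom
        app_η := fun X ↦ NatTrans.congr_app (congrArg (·.hom) (IsMonHom.one_hom f.hom)) X
        app_μ := fun X ↦ ?_ }, rfl⟩
    -- The two forms of the horizontal composite `f ◫ f` agree by naturality of `f`.
    refine (NatTrans.congr_app (congrArg (·.hom) (IsMonHom.mul_hom f.hom)) X).trans ?_
    exact congrArg (· ≫ S.obj.μ.app X) (f.hom.hom.naturality (f.hom.hom.app X)).symm⟩
  -- A monoid in finitary endofunctors is in particular one in all endofunctors, that is, a monad.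
  essSurj := ⟨fun M ↦ by
    refine ⟨⟨Monad.ofMon ((isFinitary A).ι.mapMon.obj M), M.X.property⟩,
      ⟨Mon.mkIso (Iso.refl M.X)
        ((Category.comp_id _).trans (ObjectProperty.hom_ext _ (Category.id_comp _)))
        ((Category.comp_id _).trans ((ObjectProperty.hom_ext _ (Category.id_comp _)).trans ?_))⟩⟩
    exact (Category.id_comp _).symm.trans
      (congrArg (· ≫ MonObj.mul (X := M.X)) (MonoidalCategory.id_tensorHom_id M.X M.X).symm)⟩

/-! ### The equivalence -/

theorem mainTheorem7 (A : Type u) [Category.{w} A] [IsLocallyFinitelyPresentable.{w} A]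
    {Af : Type w} [SmallCategory Af] (e : Af ≌ FinPres A) :
    Nonempty (FinitaryMonad A ≌ OneObjectCat.{w, w + 1, w + 1, t} (lexProfOfFinPres e)) := by
  have := Cardinal.fact_isRegular_aleph0.{w}
  let i : Af ⥤ A := e.functor ⋙ ObjectProperty.ι _
  have hi (c) : IsFinitelyPresentable.{w} (i.obj c) := (e.functor.obj c).property
  have : HasFiniteLimits Afᵒᵖ := (lexProfOfFinPres e).hasFiniteLimits
  have : PreservesFiniteColimits i := by
    have (J : Type) [SmallCategory J] [FinCategory J] :
        (ObjectProperty.isFinitelyPresentable.{w} A).IsClosedUnderColimitsOfShape J :=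
      isClosedUnderColimitsOfShape_isCardinalPresentable.{w} A
        ((hasCardinalLT_aleph0_iff _).2 inferInstance)
    have : PreservesFiniteColimits (ObjectProperty.isFinitelyPresentable.{w} A).ι :=
      ⟨fun J _ _ ↦ inferInstance⟩
    exact comp_preservesFiniteColimits _ _
  have h (X) : IsFiltered (CostructuredArrow i X) :=
    IsFiltered.of_equivalence
      (CostructuredArrow.pre e.functor (ObjectProperty.ι _) X).asEquivalence.symm
  let := (LexProf.coreMonoidalNerve i hi).toMonoidal
  have : (LexProf.nerve i).mapMon.EssSurj := ⟨fun M ↦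
    Functor.essImage_mapMon.2 ((LexProf.essSurj_nerve i hi).mem_essImage M.X)⟩
  have : (LexProf.nerve i).mapMon.IsEquivalence := { }
  exact ⟨(finitaryMonadToMon A).asEquivalence.trans ((LexProf.nerve i).mapMon.asEquivalence.trans
    (BicatEnrichedCategory.monEquivOneObjectCat (lexProfOfFinPres e)))⟩
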